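/- Let $\Omega\subseteq\mathbb R^n$ be a nonempty open set. Let $\omega:[0,\infty)\to[0,\infty)$ be a non-quasianalytic weight function, i.e. $\omega$ is continuous and increasing (in the wide sense), and $(\alpha)$ $\omega(2t)\le L(\omega(t)+1)$ for all $t\ge0$ and some $L>0$; $(\beta)$ $\int_1^\infty \omega(t)t^{-2}\,dt<\infty$; $(\gamma)$ $\log t=o(\omega(t))$ as $t\to\infty$; $(\delta)$ $\varphi_\omega(t):=\omega(e^t)$ is convex. Assume that $\omega$ satisfies condition B-M-M: there is $H\ge1$ with $2\omega(t)\le\omega(Ht)+H$ for all $t\ge0$. Put $\varphi_\omega^*(s)=\sup_{t\ge0}(st-\varphi_\omega(t))$ for $s\ge 0$. For a system $P=(P_j(D))_{j=1}^N$ of linear partial differential operators with constant complex coefficients, $D_j=-i\partial_{x_j}$, each of order $m$, and $\beta\in\mathbb N_0^N$, let $P^\beta=P_1(D)^{\beta_1}\circ\cdots\circ P_N(D)^{\beta_N}$. For $K\subset\mathbb R^n$ compact and $\lambda>0$ put $$p^P_{K,\lambda}(u)=\sup_{\beta\in\mathbb N_0^N}\|P^\beta u\|_{L^2(K)}\,e^{-\lambda\varphi_\omega^*(|\beta|m/\lambda)},\qquad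 \mathcal E^P_{\omega,\lambda}(K)=\{u\in C^\infty(K): p^P_{K,\lambda}(u)<\infty\},$$ where $C^\infty(K)$ denotes the smooth complex-valued functions on the interior of $K$ and the $L^2$ norm is taken over the interior of $K$. Let $\mathcal E^P_{(\omega)}(\Omega)$ (Beurling case) be the set of $u\in C^\infty(\Omega)$ such that for every compact $K\subset\Omega$ one has $u|_K\in\mathcal E^P_{\omega,\lambda}(K)$ for all $\lambda>0$, and $\mathcal E^P_{\{\omega\}}(\Omega)$ (Roumieu case) the set of $u\in C^\infty(\Omega)$ such that for every compact $K\subset\Omega$ one has $u|_K\in\mathcal E^P_{\omega,1/\ell}(K)$ for some $\ell\in\mathbb N$, $\ell\ge1$. The system $P$ satisfies condition $(\mathscr C)$ if for every $\lambda>0$ and every compact $K\subset\Omega$ the space $\mathcal E^P_{\omega,\lambda}(K)$ is a Banach space with the norm $p^P_{K,\lambda}$. Let $P=(P_j(D))_{j=1}^N$ be such a system, of order $m\ge1$, satisfying condition $(\mathscr C)$, and let $Q=(Q_j(D))_{j=1}^M$ be any system of linear partial differential operators with constant complex coefficients, each of order $r$. Let $h>0$ and $\sigma(t)=\omega(t^{r/(mh)})$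 for $t\ge 0$, and let $\mathcal E^Q_{(\sigma)}(\Omega)$, $\mathcal E^Q_{\{\sigma\}}(\Omega)$ be defined as above with $Q$, $r$, $\sigma$ in place of $P$, $m$, $\omega$. If $$\mathcal E^P_{(\omega)}(\Omega)\subseteq\mathcal E^Q_{(\sigma)}(\Omega)\qquad\text{or}\qquad \mathcal E^P_{\{\omega\}}(\Omega)\subseteq\mathcal E^Q_{\{\sigma\}}(\Omega),$$ then $Q$ is $h$-weaker than $P$: there is $C>0$ such that $$\sum_{j=1}^M|Q_j(\xi)|\le C\Bigl(1+\sum_{j=1}^N|P_j(\xi)|\Bigr)^h\qquad\text{for all }\xi\in\mathbb R^n.$$ -/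

import Mathlib

noncomputable section

namespace Iterates

/-! ### Weight functions -/

/-- Non-quasianalytic weight functions. Only the values of `ω` on `[0, ∞)` matter. -/
structure IsNonQuasianalyticWeight (ω : ℝ → ℝ) : Prop where
  continuousOn : ContinuousOn ω (Set.Ici 0)
  monotoneOn : MonotoneOn ω (Set.Ici 0)
  nonneg : ∀ t, 0 ≤ t → 0 ≤ ω t
  alpha : ∃ L : ℝ, 0 < L ∧ ∀ t, 0 ≤ t → ω (2 * t) ≤ L * (ω t + 1)
  beta : MeasureTheory.IntegrableOn (fun t : ℝ => ω t / t ^ 2) (Set.Ioi 1)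
  gamma : Asymptotics.IsLittleO Filter.atTop Real.log ω
  delta : ConvexOn ℝ Set.univ (fun t : ℝ => ω (Real.exp t))

/-- The growth condition B-M-M. -/
def ConditionBMM (ω : ℝ → ℝ) : Prop :=
  ∃ H : ℝ, 1 ≤ H ∧ ∀ t, 0 ≤ t → 2 * ω t ≤ ω (H * t) + H

/-- The Young conjugate `φ*(s) = sup_{t ≥ 0} (s t - φ(t))` of `φ(t) = ω(e^t)`.
For a weight function the supremum is finite, because `log t = o(ω(t))`. -/
def youngConj (ω : ℝ → ℝ) (s : ℝ) : ℝ :=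
  ⨆ t : Set.Ici (0 : ℝ), (s * (t : ℝ) - ω (Real.exp (t : ℝ)))

/-! ### Differential operators with constant coefficients -/

/-- `D_j u = -i ∂_j u`. -/
def D {n : ℕ} (j : Fin n) (u : EuclideanSpace ℝ (Fin n) → ℂ) :
    EuclideanSpace ℝ (Fin n) → ℂ :=
  fun x => -Complex.I * fderiv ℝ u x (EuclideanSpace.single j 1)

/-- `D^α = D_1^{α_1} ∘ ⋯ ∘ D_n^{α_n}`. -/
def Dpow {n : ℕ} (α : Fin n → ℕ) (u : EuclideanSpace ℝ (Fin n) → ℂ) :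
    EuclideanSpace ℝ (Fin n) → ℂ :=
  (List.finRange n).foldr (fun j v => (D j)^[α j] v) u

/-- The operator `p(D) = ∑_α c_α D^α` of the polynomial `p(ξ) = ∑_α c_α ξ^α`. -/
def diffOp {n : ℕ} (p : MvPolynomial (Fin n) ℂ) (u : EuclideanSpace ℝ (Fin n) → ℂ) :
    EuclideanSpace ℝ (Fin n) → ℂ :=
  fun x => ∑ α ∈ p.support, p.coeff α * Dpow (fun j => α j) u x

/-- The iterates `P^β = P_1(D)^{β_1} ∘ ⋯ ∘ P_N(D)^{β_N}` of a system `P = (P_j(D))_j`. -/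
def iterateOp {n N : ℕ} (P : Fin N → MvPolynomial (Fin n) ℂ) (β : Fin N → ℕ)
    (u : EuclideanSpace ℝ (Fin n) → ℂ) : EuclideanSpace ℝ (Fin n) → ℂ :=
  (List.finRange N).foldr (fun j v => (diffOp (P j))^[β j] v) u

/-- A system has order `m` if each of its operators has order `m`. -/
def HasOrder {n N : ℕ} (P : Fin N → MvPolynomial (Fin n) ℂ) (m : ℕ) : Prop :=
  ∀ j, (P j).totalDegree = m

/-- The symbol `p(ξ)` at a real point `ξ`. -/
def symbol {n : ℕ} (p : MvPolynomial (Fin n) ℂ) (ξ : EuclideanSpace ℝ (Fin n)) : ℂ :=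
  MvPolynomial.eval (fun i => ((ξ i : ℝ) : ℂ)) p

/-- `Q` is `h`-weaker than `P`. -/
def IsWeaker {n N M : ℕ} (h : ℝ) (Q : Fin M → MvPolynomial (Fin n) ℂ)
    (P : Fin N → MvPolynomial (Fin n) ℂ) : Prop :=
  0 < h ∧ ∃ C : ℝ, 0 < C ∧ ∀ ξ : EuclideanSpace ℝ (Fin n),
    ∑ j, ‖symbol (Q j) ξ‖ ≤ C * (1 + ∑ j, ‖symbol (P j) ξ‖) ^ h

/-! ### Ultradifferentiable functions with respect to the iterates of a system -/

/-- The semi-norm `sup_β ‖P^β u‖_{L²(K)} exp(-lam φ*(|β| m / lam))`, with values in `[0, ∞]`.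
Functions on `K` are functions on the interior of `K`, so the `L²` norm is taken there. -/
def seminormK {n N : ℕ} (ω : ℝ → ℝ) (P : Fin N → MvPolynomial (Fin n) ℂ) (m : ℕ)
    (lam : ℝ) (K : Set (EuclideanSpace ℝ (Fin n)))
    (u : EuclideanSpace ℝ (Fin n) → ℂ) : ENNReal :=
  ⨆ β : Fin N → ℕ,
    MeasureTheory.eLpNorm (iterateOp P β u) 2 (MeasureTheory.volume.restrict (interior K)) *
      ENNReal.ofReal
        (Real.exp (-(lam * youngConj ω (((∑ j, β j : ℕ) : ℝ) * (m : ℝ) / lam))))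

/-- The smooth functions `u` on (the interior of) the compact set `K` with finite semi-norm.
Their values outside the interior of `K` are irrelevant. -/
def spaceK {n N : ℕ} (ω : ℝ → ℝ) (P : Fin N → MvPolynomial (Fin n) ℂ) (m : ℕ)
    (lam : ℝ) (K : Set (EuclideanSpace ℝ (Fin n))) :
    Set (EuclideanSpace ℝ (Fin n) → ℂ) :=
  {u | ContDiffOn ℝ (⊤ : ℕ∞) u (interior K) ∧ seminormK ω P m lam K u < ⊤}

/-- The Beurling class on `Ω`: smooth functions on `Ω` that lie in the space over `K` with
parameter `lam` for every compact `K ⊆ Ω` and every `lam > 0`. -/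
def beurling {n N : ℕ} (ω : ℝ → ℝ) (P : Fin N → MvPolynomial (Fin n) ℂ) (m : ℕ)
    (Ω : Set (EuclideanSpace ℝ (Fin n))) : Set (EuclideanSpace ℝ (Fin n) → ℂ) :=
  {u | ContDiffOn ℝ (⊤ : ℕ∞) u Ω ∧ ∀ K, IsCompact K → K ⊆ Ω →
    ∀ lam : ℝ, 0 < lam → u ∈ spaceK ω P m lam K}

/-- The Roumieu class on `Ω`: smooth functions on `Ω` that for every compact `K ⊆ Ω` lie in
the space over `K` with parameter `1/l` for some positive integer `l`. -/
def roumieu {n N : ℕ} (ω : ℝ → ℝ) (P : Fin N → MvPolynomial (Fin n) ℂ) (m : ℕ)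
    (Ω : Set (EuclideanSpace ℝ (Fin n))) : Set (EuclideanSpace ℝ (Fin n) → ℂ) :=
  {u | ContDiffOn ℝ (⊤ : ℕ∞) u Ω ∧ ∀ K, IsCompact K → K ⊆ Ω →
    ∃ l : ℕ, 0 < l ∧ u ∈ spaceK ω P m (1 / (l : ℝ)) K}

/-- Condition `(C)`: for all `lam > 0` and compact `K ⊆ Ω`, the space over `K` is a Banach
space, i.e. complete for its norm (functions that agree on the interior of `K` are identified;
then the semi-norm is a norm, since a continuous function with zero `L²` norm on an open set
vanishes there). -/
def ConditionC {n N : ℕ} (ω : ℝ → ℝ) (P : Fin N → MvPolynomial (Fin n) ℂ) (m : ℕ)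
    (Ω : Set (EuclideanSpace ℝ (Fin n))) : Prop :=
  ∀ lam : ℝ, 0 < lam → ∀ K, IsCompact K → K ⊆ Ω →
    ∀ u : ℕ → EuclideanSpace ℝ (Fin n) → ℂ,
      (∀ k, u k ∈ spaceK ω P m lam K) →
      (∀ ε : ENNReal, 0 < ε → ∃ k₀, ∀ k ≥ k₀, ∀ l ≥ k₀,
        seminormK ω P m lam K (u k - u l) < ε) →
      ∃ v ∈ spaceK ω P m lam K,
        Filter.Tendsto (fun k => seminormK ω P m lam K (u k - v)) Filter.atTop (nhds 0)

end Iterates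

end

noncomputable section

open Set Filter Topology MeasureTheory
open scoped ENNReal BoundedContinuousFunction

namespace Iterates

/-! ### Convex functions on the line and Young conjugates -/

/-! Write `S = 1 + ∑ |P_j|`, and suppose that some `|Q_j|` is not bounded by a multiple of `S ^ h`.
Then there are frequencies `ξ_p` at which `q_p = |Q_j(ξ_p)|` exceeds `S_p ^ h` by any prescribed
factor. Put `y_p = ω(S_p ^ (1/m))` and `z_p = ω(q_p ^ (1/(m h)))`. Iterating B-M-M shows that `z_p`
is at least about `2 ^ p * y_p`. Hence coefficients `c_p = 2 ^ (-p) exp(-(3/4) ^ p z_p)` beat every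
`exp(-λ y_p)` but decay more slowly than every `exp(-λ z_p)`.

The first property puts every series `∑ a_p c_p exp(i⟨x, ξ_p⟩)` with bounded `a` into the Beurling
class of `P` (`tsum_wave_mem_beurling`). The coefficients control only the symbols of `P`, not
powers of `ξ_p`, so smoothness of the sum cannot come from termwise differentiation; it comes from
the completeness in condition (C).

Either inclusion implies that the Beurling class of `P` lies in the Roumieu class of `Q`. Baire's
theorem on the space of bounded sequences then yields one `λ` and one `C` serving all `p` and all
iterates (`exists_uniform_bound_of_mem_roumieu`). Powers of `Q_j` alone, with the best exponent,
turn this into `c_p exp(λ z_p - log q_p) ≤ C` (`exp_le_of_uniform_bound`). Since `log q_p = o(z_p)`,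
this contradicts the slow decay of `c_p`. -/

lemma exists_subgradient {f : ℝ → ℝ} (hf : ConvexOn ℝ univ f) (x : ℝ) :
    ∃ s : ℝ, ∀ y, f x + s * (y - x) ≤ f y := by
  have hmono : ∀ y z, y < x → x < z → slope f x y ≤ slope f x z := fun y z hy hz =>
    hf.slope_mono (mem_univ x) ⟨mem_univ y, hy.ne⟩ ⟨mem_univ z, hz.ne'⟩ (hy.trans hz).le
  have hbdd : BddBelow (slope f x '' Ioi x) := by
    refine ⟨slope f x (x - 1), ?_⟩
    rintro _ ⟨z, hz, rfl⟩
    exact hmono _ _ (by linarith) hz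
  -- The right derivative at `x`; it lies between all slopes to the left and all slopes to the
  -- right.
  refine ⟨sInf (slope f x '' Ioi x), fun y => ?_⟩
  rcases lt_trichotomy y x with hy | rfl | hy
  · have h1 : slope f x y ≤ sInf (slope f x '' Ioi x) := by
      refine le_csInf ⟨_, x + 1, by simp, rfl⟩ ?_
      rintro _ ⟨z, hz, rfl⟩
      exact hmono _ _ hy hz
    rw [slope_def_field, div_le_iff_of_neg (by linarith)] at h1
    linarith
  · simp
  · have h1 : sInf (slope f x '' Ioi x) ≤ slope f x y := csInf_le hbdd ⟨y, hy, rfl⟩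
    rw [slope_def_field, le_div_iff₀ (by linarith)] at h1
    linarith

/-- The Fenchel-Young inequality. -/
lemma IsNonQuasianalyticWeight.sub_le_youngConj {ω : ℝ → ℝ} (hω : IsNonQuasianalyticWeight ω)
    (s : ℝ) {t : ℝ} (ht : 0 ≤ t) : s * t - ω (Real.exp t) ≤ youngConj ω s := by
  -- An unbounded real supremum would default to `0`. Condition (γ) excludes this: `(|s| + 1) t ≤
  -- ω(e^t)` for large `t`.
  have hbdd : BddAbove (range fun t : Ici (0 : ℝ) => s * (t : ℝ) - ω (Real.exp t)) := by
    have h1 := (hω.gamma.bound (show (0 : ℝ) < 1 / (|s| + 1) by positivity))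
    have h2 := Real.tendsto_exp_atTop.eventually h1
    obtain ⟨T, hT⟩ := eventually_atTop.1 h2
    refine ⟨|s| * |T|, ?_⟩
    rintro _ ⟨⟨t, ht⟩, rfl⟩
    have ht' : (0 : ℝ) ≤ t := ht
    have hpos := hω.nonneg _ (Real.exp_pos t).le
    simp only
    rcases le_total T t with h | h
    · have h3 := hT t h
      rw [Real.log_exp, Real.norm_of_nonneg ht', Real.norm_of_nonneg hpos, one_div,
        inv_mul_eq_div, le_div_iff₀ (by positivity)] at h3
      have h4 : s * t ≤ |s| * t := mul_le_mul_of_nonneg_right (le_abs_self s) ht'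
      have h5 : 0 ≤ |s| * |T| := by positivity
      nlinarith
    · have h4 : s * t ≤ |s| * t := mul_le_mul_of_nonneg_right (le_abs_self s) ht'
      have h5 : |s| * t ≤ |s| * |T| :=
        mul_le_mul_of_nonneg_left (h.trans (le_abs_self T)) (abs_nonneg s)
      linarith
  exact le_ciSup hbdd ⟨t, ht⟩

/-- Powers of `S` are dominated by the weight evaluated at `S ^ (1 / m)`. -/
lemma IsNonQuasianalyticWeight.pow_mul_exp_le {ω : ℝ → ℝ} (hω : IsNonQuasianalyticWeight ω)
    {S : ℝ} (hS : 1 ≤ S) {m : ℕ} (hm : 1 ≤ m) {lam : ℝ} (hlam : 0 < lam) (k : ℕ) :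
    S ^ k * Real.exp (-(lam * youngConj ω ((k : ℝ) * m / lam))) ≤
      Real.exp (lam * ω (S ^ (1 / (m : ℝ)))) := by
  have hm' : (0 : ℝ) < m := by exact_mod_cast hm
  have hS0 : 0 < S := by linarith
  -- Fenchel-Young is applied at `t = log S / m`, where the linear term is exactly `log (S ^ k)`;
  -- the resulting bound does not depend on `k`.
  have ht : 0 ≤ Real.log S / m := div_nonneg (Real.log_nonneg hS) hm'.le
  have h1 := hω.sub_le_youngConj ((k : ℝ) * m / lam) ht
  have h2 : Real.exp (Real.log S / m) = S ^ (1 / (m : ℝ)) := by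
    rw [Real.rpow_def_of_pos hS0, mul_one_div]
  have h3 : S ^ k = Real.exp (k * Real.log S) := by
    rw [Real.exp_nat_mul, Real.exp_log hS0]
  rw [h3, ← Real.exp_add, Real.exp_le_exp, ← h2]
  have h4 : lam * ((k : ℝ) * m / lam * (Real.log S / m) - ω (Real.exp (Real.log S / m))) ≤
      lam * youngConj ω ((k : ℝ) * m / lam) := mul_le_mul_of_nonneg_left h1 hlam.le
  have h5 : lam * ((k : ℝ) * m / lam * (Real.log S / m)) = k * Real.log S := by
    field_simp
  rw [mul_sub, h5] at h4
  linarith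

/-- A convex increasing `φ = σ ∘ exp` is recovered from its Young conjugate at the points
`k r / lam`, up to an error coming from the spacing of these points. -/
lemma exists_nat_le_youngConj {σ : ℝ → ℝ} (hconv : ConvexOn ℝ univ fun t => σ (Real.exp t))
    (hmono : Monotone fun t => σ (Real.exp t)) {r lam t : ℝ} (hr : 0 < r) (hlam : 0 < lam)
    (ht : 0 ≤ t) :
    ∃ k : ℕ, lam * σ (Real.exp t) - r * t ≤ k * (r * t) - lam * youngConj σ (k * r / lam) := by
  obtain ⟨s, hs⟩ := exists_subgradient hconv t
  have hs0 : 0 ≤ s := by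
    have h1 := hs (t - 1)
    have h2 : σ (Real.exp (t - 1)) ≤ σ (Real.exp t) := hmono (by linarith)
    linarith
  -- The conjugate is attained at the slope `s`; rounding `s` down to a multiple of `r / lam` costs
  -- at most `r * t` after multiplication by `lam`.
  set k := ⌊s * lam / r⌋₊ with hk
  have hk1 : (k : ℝ) ≤ s * lam / r := Nat.floor_le (by positivity)
  have hk2 : s * lam / r < k + 1 := Nat.lt_floor_add_one _
  rw [le_div_iff₀ hr] at hk1
  rw [div_lt_iff₀ hr] at hk2
  have hks : k * r / lam ≤ s := by rwa [div_le_iff₀ hlam]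
  have hY : youngConj σ (k * r / lam) ≤ s * t - σ (Real.exp t) := by
    have : Nonempty (Ici (0 : ℝ)) := ⟨⟨0, self_mem_Ici⟩⟩
    refine ciSup_le fun ⟨y, hy⟩ => ?_
    have hy' : (0 : ℝ) ≤ y := hy
    have h1 := hs y
    have h2 := mul_le_mul_of_nonneg_right hks hy'
    simp only
    linarith
  refine ⟨k, ?_⟩
  have h3 := mul_le_mul_of_nonneg_left hY hlam.le
  have h4 := mul_le_mul_of_nonneg_right hk2.le ht
  nlinarith

/-! ### Condition B-M-M -/

/-- Subtracting `H` puts B-M-M in the form `2 (ω t - H) ≤ ω (H t) - H`, which iterates without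
accumulating error terms. -/
lemma ConditionBMM.exists_pow {ω : ℝ → ℝ} (h : ConditionBMM ω) :
    ∃ H : ℝ, 1 ≤ H ∧ ∀ (p : ℕ) (t : ℝ), 0 ≤ t → 2 ^ p * (ω t - H) ≤ ω (H ^ p * t) - H := by
  obtain ⟨H, hH, hω⟩ := h
  refine ⟨H, hH, fun p => ?_⟩
  induction p with
  | zero => intro t _; simp
  | succ p ih =>
    intro t ht
    have h1 := ih (H * t) (by positivity)
    have h2 := hω t ht
    have h3 : (0 : ℝ) < 2 ^ p := by positivity
    rw [show H ^ (p + 1) * t = H ^ p * (H * t) by ring]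
    refine le_trans ?_ h1
    rw [pow_succ, mul_assoc]
    exact mul_le_mul_of_nonneg_left (by linarith) h3.le

section Operators

variable {n : ℕ}

/-! ### Exponentials -/

/-- The exponential `x ↦ e^{i⟨x, ξ⟩}`. -/
def wave (ξ x : EuclideanSpace ℝ (Fin n)) : ℂ := Complex.exp (Complex.I * ((inner ℝ ξ x : ℝ) : ℂ))

lemma norm_wave (ξ x : EuclideanSpace ℝ (Fin n)) : ‖wave ξ x‖ = 1 := by
  rw [wave, mul_comm, Complex.norm_exp_ofReal_mul_I]

lemma wave_neg_mul_wave (ξ x : EuclideanSpace ℝ (Fin n)) : wave ξ x * wave (-ξ) x = 1 := by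
  rw [wave, wave, ← Complex.exp_add, inner_neg_left]
  simp

lemma contDiff_wave (ξ : EuclideanSpace ℝ (Fin n)) {k : WithTop ℕ∞} : ContDiff ℝ k (wave ξ) := by
  have h : ContDiff ℝ k fun x : EuclideanSpace ℝ (Fin n) => ((inner ℝ ξ x : ℝ) : ℂ) :=
    Complex.ofRealCLM.contDiff.comp (contDiff_const.inner ℝ contDiff_id)
  exact (contDiff_const.mul h).cexp

lemma continuous_wave (ξ : EuclideanSpace ℝ (Fin n)) : Continuous (wave ξ) :=
  (contDiff_wave ξ (k := 0)).continuous

lemma fderiv_wave_single (ξ x : EuclideanSpace ℝ (Fin n)) (j : Fin n) :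
    fderiv ℝ (wave ξ) x (EuclideanSpace.single j 1) = Complex.I * (ξ j : ℂ) * wave ξ x := by
  have h1 : HasFDerivAt (fun x : EuclideanSpace ℝ (Fin n) => ((inner ℝ ξ x : ℝ) : ℂ))
      (Complex.ofRealCLM.comp (innerSL ℝ ξ)) x :=
    Complex.ofRealCLM.hasFDerivAt.comp x (innerSL ℝ ξ).hasFDerivAt
  have h2 := (h1.const_mul Complex.I).cexp
  have h3 : fderiv ℝ (wave ξ) x = _ := h2.fderiv
  rw [h3]
  simp [wave, EuclideanSpace.inner_single_right]
  ring

/-- Finite sums of exponentials. -/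
def waveSum {ι : Type*} (s : Finset ι) (ξ : ι → EuclideanSpace ℝ (Fin n)) (b : ι → ℂ)
    (x : EuclideanSpace ℝ (Fin n)) : ℂ :=
  ∑ p ∈ s, b p * wave (ξ p) x

section WaveSum

variable {ι : Type*} (s : Finset ι) (ξ : ι → EuclideanSpace ℝ (Fin n))

lemma contDiff_waveSum (b : ι → ℂ) {k : WithTop ℕ∞} : ContDiff ℝ k (waveSum s ξ b) :=
  ContDiff.sum fun p _ => contDiff_const.mul (contDiff_wave (ξ p))

lemma norm_waveSum_le (b : ι → ℂ) (x : EuclideanSpace ℝ (Fin n)) :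
    ‖waveSum s ξ b x‖ ≤ ∑ p ∈ s, ‖b p‖ :=
  (norm_sum_le _ _).trans_eq (Finset.sum_congr rfl fun p _ => by rw [norm_mul, norm_wave, mul_one])

lemma D_waveSum (b : ι → ℂ) (j : Fin n) :
    D j (waveSum s ξ b) = waveSum s ξ fun p => (ξ p j : ℂ) * b p := by
  funext x
  have hd : ∀ p, DifferentiableAt ℝ (wave (ξ p)) x := fun p =>
    (contDiff_wave (ξ p) (k := 1)).differentiable one_ne_zero x
  have h1 : fderiv ℝ (waveSum s ξ b) x = ∑ p ∈ s, b p • fderiv ℝ (wave (ξ p)) x := by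
    unfold waveSum
    rw [fderiv_fun_sum fun p _ => (hd p).const_mul (b p)]
    exact Finset.sum_congr rfl fun p _ => fderiv_const_mul (hd p) (b p)
  simp only [D, h1, waveSum, sum_apply, smul_apply,
    fderiv_wave_single, smul_eq_mul, Finset.mul_sum]
  refine Finset.sum_congr rfl fun p _ => ?_
  linear_combination (-(b p * (ξ p j : ℂ) * wave (ξ p) x)) * Complex.I_mul_I

/-- An operator acting on sums of exponentials by multiplication with `a` acts by
`a ^ k` when iterated. -/
lemma iterate_waveSum {A : (EuclideanSpace ℝ (Fin n) → ℂ) → EuclideanSpace ℝ (Fin n) → ℂ}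
    {a : ι → ℂ} (hA : ∀ b, A (waveSum s ξ b) = waveSum s ξ fun p => a p * b p) (k : ℕ) (b : ι → ℂ) :
    A^[k] (waveSum s ξ b) = waveSum s ξ fun p => a p ^ k * b p := by
  induction k generalizing b with
  | zero => simp
  | succ k ih =>
    rw [Function.iterate_succ_apply, hA, ih]
    simp only [pow_succ, mul_assoc]

lemma foldr_waveSum {J : Type*}
    {A : J → (EuclideanSpace ℝ (Fin n) → ℂ) → EuclideanSpace ℝ (Fin n) → ℂ}
    {a : J → ι → ℂ} (hA : ∀ j b, A j (waveSum s ξ b) = waveSum s ξ fun p => a j p * b p)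
    (β : J → ℕ) (l : List J) (b : ι → ℂ) :
    l.foldr (fun j v => (A j)^[β j] v) (waveSum s ξ b) =
      waveSum s ξ fun p => (l.map fun j => a j p ^ β j).prod * b p := by
  induction l with
  | nil => simp
  | cons j l ih =>
    rw [List.foldr_cons, ih, iterate_waveSum s ξ (hA j)]
    simp only [List.map_cons, List.prod_cons, mul_assoc]

lemma Dpow_waveSum (α : Fin n → ℕ) (b : ι → ℂ) :
    Dpow α (waveSum s ξ b) = waveSum s ξ fun p => (∏ j, (ξ p j : ℂ) ^ α j) * b p := by
  rw [Dpow, foldr_waveSum s ξ (fun j b => D_waveSum s ξ b j)]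
  simp only [← List.ofFn_eq_map, List.prod_ofFn]

lemma diffOp_waveSum (q : MvPolynomial (Fin n) ℂ) (b : ι → ℂ) :
    diffOp q (waveSum s ξ b) = waveSum s ξ fun p => symbol q (ξ p) * b p := by
  funext x
  simp only [diffOp, Dpow_waveSum, waveSum, symbol, MvPolynomial.eval_eq', Finset.mul_sum,
    Finset.sum_mul]
  rw [Finset.sum_comm]
  exact Finset.sum_congr rfl fun p _ => Finset.sum_congr rfl fun α _ => by ring

lemma iterateOp_waveSum {N : ℕ} (P : Fin N → MvPolynomial (Fin n) ℂ) (β : Fin N → ℕ) (b : ι → ℂ) :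
    iterateOp P β (waveSum s ξ b) =
      waveSum s ξ fun p => (∏ j, symbol (P j) (ξ p) ^ β j) * b p := by
  rw [iterateOp, foldr_waveSum s ξ (fun j b => diffOp_waveSum s ξ (P j) b)]
  simp only [← List.ofFn_eq_map, List.prod_ofFn]

end WaveSum

lemma iterateOp_wave {N : ℕ} (P : Fin N → MvPolynomial (Fin n) ℂ) (β : Fin N → ℕ)
    (ξ : EuclideanSpace ℝ (Fin n)) :
    iterateOp P β (wave ξ) = fun x => (∏ j, symbol (P j) ξ ^ β j) * wave ξ x := by
  have h1 : wave ξ = waveSum {()} (fun _ => ξ) fun _ => 1 := by funext x; simp [waveSum]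
  rw [h1, iterateOp_waveSum]
  funext x
  simp [waveSum]

/-! ### Local operators with a transpose -/

/-- Test functions in `U`. -/
structure IsTestFunction (U : Set (EuclideanSpace ℝ (Fin n)))
    (φ : EuclideanSpace ℝ (Fin n) → ℂ) : Prop where
  contDiff : ContDiff ℝ (⊤ : ℕ∞) φ
  hasCompactSupport : HasCompactSupport φ
  tsupport_subset : tsupport φ ⊆ U

/-- Operators that act on the smooth functions on `U`, are local and have a transpose acting on
test functions. -/
structure IsLocalOperator (U : Set (EuclideanSpace ℝ (Fin n)))
    (A : (EuclideanSpace ℝ (Fin n) → ℂ) → EuclideanSpace ℝ (Fin n) → ℂ) : Prop where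
  smooth : ∀ u, ContDiffOn ℝ (⊤ : ℕ∞) u U → ContDiffOn ℝ (⊤ : ℕ∞) (A u) U
  eqOn : ∀ u v, EqOn u v U → EqOn (A u) (A v) U
  transpose : ∀ φ, IsTestFunction U φ → ∃ ψ, IsTestFunction U ψ ∧
    ∀ u, ContDiffOn ℝ (⊤ : ℕ∞) u U → ∫ x, A u x * φ x = ∫ x, u x * ψ x

variable {U : Set (EuclideanSpace ℝ (Fin n))}

namespace IsTestFunction

lemma sum {ι : Type*} {s : Finset ι} {φ : ι → EuclideanSpace ℝ (Fin n) → ℂ}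
    (h : ∀ i ∈ s, IsTestFunction U (φ i)) : IsTestFunction U fun x => ∑ i ∈ s, φ i x := by
  classical
  induction s using Finset.induction_on with
  | empty =>
    refine ⟨by simpa using contDiff_const, ?_, ?_⟩
    · exact HasCompactSupport.zero
    · simp [tsupport]
  | insert i s hi ih =>
    obtain ⟨h1, h2, h3⟩ := ih fun j hj => h j (Finset.mem_insert_of_mem hj)
    obtain ⟨g1, g2, g3⟩ := h i (Finset.mem_insert_self i s)
    simp only [Finset.sum_insert hi]
    exact ⟨g1.add h1, g2.add h2, (tsupport_add _ _).trans (union_subset g3 h3)⟩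

lemma mul_left {φ f : EuclideanSpace ℝ (Fin n) → ℂ} (h : IsTestFunction U φ)
    (hf : ContDiff ℝ (⊤ : ℕ∞) f) : IsTestFunction U fun x => f x * φ x :=
  ⟨hf.mul h.contDiff, h.hasCompactSupport.mul_left,
    (tsupport_mul_subset_right (f := f) (g := φ)).trans h.tsupport_subset⟩

lemma fderiv_apply {φ : EuclideanSpace ℝ (Fin n) → ℂ} (h : IsTestFunction U φ)
    (v : EuclideanSpace ℝ (Fin n)) : IsTestFunction U fun x => fderiv ℝ φ x v := by
  refine ⟨(h.contDiff.fderiv_right (by simp)).clm_apply contDiff_const,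
    h.hasCompactSupport.fderiv_apply ℝ v, ?_⟩
  refine (closure_mono ?_).trans ((tsupport_fderiv_subset ℝ).trans h.tsupport_subset)
  intro x hx h0
  exact hx (by simp [h0])

/-- Nothing is assumed about `u` outside `U`: the product is continuous everywhere because it
vanishes off the support of `φ`. -/
lemma integrable_mul {φ u : EuclideanSpace ℝ (Fin n) → ℂ} (h : IsTestFunction U φ)
    (hU : IsOpen U) (hu : ContinuousOn u U) : Integrable fun x => u x * φ x := by
  have hc : Continuous fun x => u x * φ x := by
    refine continuous_iff_continuousAt.2 fun x => ?_
    by_cases hx : x ∈ tsupport φ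
    · exact (hu.continuousAt (hU.mem_nhds (h.tsupport_subset hx))).mul
        h.contDiff.continuous.continuousAt
    · have h1 : (fun x => u x * φ x) =ᶠ[𝓝 x] fun _ => 0 := by
        filter_upwards [(isClosed_tsupport φ).isOpen_compl.mem_nhds hx] with y hy
        rw [image_eq_zero_of_notMem_tsupport hy, mul_zero]
      exact continuousAt_const.congr h1.symm
  exact hc.integrable_of_hasCompactSupport h.hasCompactSupport.mul_left

end IsTestFunction

namespace IsLocalOperator

variable {A B : (EuclideanSpace ℝ (Fin n) → ℂ) → EuclideanSpace ℝ (Fin n) → ℂ}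

lemma id : IsLocalOperator U fun u => u :=
  ⟨fun _ h => h, fun _ _ h => h, fun φ hφ => ⟨φ, hφ, fun _ _ => rfl⟩⟩

lemma comp (hA : IsLocalOperator U A) (hB : IsLocalOperator U B) :
    IsLocalOperator U fun u => A (B u) := by
  refine ⟨fun u hu => hA.smooth _ (hB.smooth u hu), fun u v h => hA.eqOn _ _ (hB.eqOn u v h),
    fun φ hφ => ?_⟩
  obtain ⟨ψ, hψ, h1⟩ := hA.transpose φ hφ
  obtain ⟨χ, hχ, h2⟩ := hB.transpose ψ hψ
  exact ⟨χ, hχ, fun u hu => (h1 _ (hB.smooth u hu)).trans (h2 u hu)⟩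

lemma iterate (hA : IsLocalOperator U A) (k : ℕ) : IsLocalOperator U A^[k] := by
  induction k with
  | zero => exact id
  | succ k ih => exact ih.comp hA

lemma foldr {J : Type*}
    {F : J → (EuclideanSpace ℝ (Fin n) → ℂ) → EuclideanSpace ℝ (Fin n) → ℂ}
    (hF : ∀ j, IsLocalOperator U (F j)) (β : J → ℕ) (l : List J) :
    IsLocalOperator U fun u => l.foldr (fun j v => (F j)^[β j] v) u := by
  induction l with
  | nil => exact id
  | cons j l ih => exact ((hF j).iterate (β j)).comp ih

lemma linearCombination {ι : Type*} (hU : IsOpen U) (s : Finset ι) (c : ι → ℂ)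
    {F : ι → (EuclideanSpace ℝ (Fin n) → ℂ) → EuclideanSpace ℝ (Fin n) → ℂ}
    (hF : ∀ i, IsLocalOperator U (F i)) :
    IsLocalOperator U fun u x => ∑ i ∈ s, c i * F i u x := by
  refine ⟨fun u hu => ContDiffOn.sum fun i _ => contDiffOn_const.mul ((hF i).smooth u hu),
    fun u v h x hx => Finset.sum_congr rfl fun i _ => by rw [(hF i).eqOn u v h hx],
    fun φ hφ => ?_⟩
  choose ψ hψ h1 using fun i => (hF i).transpose φ hφ
  have htest : ∀ i, IsTestFunction U fun x => c i * ψ i x := fun i =>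
    (hψ i).mul_left contDiff_const
  refine ⟨fun x => ∑ i ∈ s, c i * ψ i x, IsTestFunction.sum fun i _ => htest i, fun u hu => ?_⟩
  simp only [Finset.sum_mul, Finset.mul_sum]
  rw [integral_finsetSum _ fun i _ => ?_, integral_finsetSum _ fun i _ => ?_]
  · refine Finset.sum_congr rfl fun i _ => ?_
    simp only [mul_assoc, mul_left_comm _ (c i)]
    rw [integral_const_mul, integral_const_mul, h1 i u hu]
  · exact (htest i).integrable_mul hU hu.continuousOn
  · exact hφ.integrable_mul hU (continuousOn_const.mul ((hF i).smooth u hu).continuousOn)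

lemma D (hU : IsOpen U) (j : Fin n) : IsLocalOperator U (D j) := by
  refine ⟨fun u hu => ?_, fun u v h x hx => ?_, fun φ hφ => ?_⟩
  · exact contDiffOn_const.mul ((hu.fderiv_of_isOpen hU (by simp)).clm_apply contDiffOn_const)
  · have h1 : u =ᶠ[𝓝 x] v := by
      filter_upwards [hU.mem_nhds hx] with y hy using h hy
    simp only [Iterates.D, h1.fderiv_eq]
  -- Integration by parts: the transpose of `D_j` is `-D_j`.
  · refine ⟨fun x => Complex.I * fderiv ℝ φ x (EuclideanSpace.single j 1),
      (hφ.fderiv_apply _).mul_left contDiff_const, fun u hu => ?_⟩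
    have hdu : ContDiffOn ℝ (⊤ : ℕ∞) (fun x => fderiv ℝ u x (EuclideanSpace.single j 1)) U :=
      (hu.fderiv_of_isOpen hU (by simp)).clm_apply contDiffOn_const
    have h1 := integral_mul_fderiv_eq_neg_fderiv_mul_of_integrable (μ := volume) (f := u) (g := φ)
      (v := EuclideanSpace.single j 1) (hφ.integrable_mul hU hdu.continuousOn)
      ((hφ.fderiv_apply _).integrable_mul hU hu.continuousOn)
      (hφ.integrable_mul hU hu.continuousOn)
      (fun x hx => (hu.contDiffAt (hU.mem_nhds (hφ.tsupport_subset hx))).differentiableAt (by simp))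
      (fun x _ => hφ.contDiff.differentiable (by simp) x)
    simp only [Iterates.D, mul_assoc, mul_left_comm _ Complex.I]
    rw [integral_const_mul, integral_const_mul, h1]
    ring

lemma diffOp (hU : IsOpen U) (q : MvPolynomial (Fin n) ℂ) : IsLocalOperator U (diffOp q) :=
  linearCombination hU q.support (fun α => q.coeff α)
    fun α => foldr (fun j => D hU j) (fun j => α j) _

lemma iterateOp (hU : IsOpen U) {N : ℕ} (P : Fin N → MvPolynomial (Fin n) ℂ) (β : Fin N → ℕ) :
    IsLocalOperator U (iterateOp P β) :=
  foldr (fun j => diffOp hU (P j)) β _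

end IsLocalOperator

end Operators

/-! ### Series of exponentials in the Beurling class -/

section Beurling

variable {n N : ℕ} {ω : ℝ → ℝ} {P : Fin N → MvPolynomial (Fin n) ℂ} {m : ℕ} {lam : ℝ}
  {K : Set (EuclideanSpace ℝ (Fin n))}

/-- The size `1 + ∑_j |P_j(ξ)|` of the symbols of a system. -/
def symbolSize (P : Fin N → MvPolynomial (Fin n) ℂ) (ξ : EuclideanSpace ℝ (Fin n)) : ℝ :=
  1 + ∑ j, ‖symbol (P j) ξ‖

lemma one_le_symbolSize (P : Fin N → MvPolynomial (Fin n) ℂ) (ξ : EuclideanSpace ℝ (Fin n)) :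
    1 ≤ symbolSize P ξ :=
  le_add_of_nonneg_right (Finset.sum_nonneg fun _ _ => norm_nonneg _)

lemma norm_prod_symbol_le (P : Fin N → MvPolynomial (Fin n) ℂ) (β : Fin N → ℕ)
    (ξ : EuclideanSpace ℝ (Fin n)) :
    ‖∏ j, symbol (P j) ξ ^ β j‖ ≤ symbolSize P ξ ^ ∑ j, β j := by
  rw [norm_prod, ← Finset.prod_pow_eq_pow_sum]
  refine Finset.prod_le_prod (fun _ _ => norm_nonneg _) fun j _ => ?_
  rw [norm_pow]
  refine pow_le_pow_left₀ (norm_nonneg _) ?_ _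
  have h1 : ‖symbol (P j) ξ‖ ≤ ∑ j, ‖symbol (P j) ξ‖ :=
    Finset.single_le_sum (f := fun j => ‖symbol (P j) ξ‖) (fun _ _ => norm_nonneg _)
      (Finset.mem_univ j)
  exact h1.trans (le_add_of_nonneg_left zero_le_one)

lemma iterateOp_zero (u : EuclideanSpace ℝ (Fin n) → ℂ) : iterateOp P 0 u = u := by
  simp [iterateOp]

/-- Differential operators are local. This lets the sum of a series replace the abstract limit
supplied by condition (C). -/
lemma seminormK_congr {u v : EuclideanSpace ℝ (Fin n) → ℂ} (h : EqOn u v (interior K)) :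
    seminormK ω P m lam K u = seminormK ω P m lam K v := by
  refine iSup_congr fun β => ?_
  congr 1
  refine eLpNorm_congr_ae ?_
  filter_upwards [ae_restrict_mem isOpen_interior.measurableSet] with x hx
  exact (IsLocalOperator.iterateOp isOpen_interior P β).eqOn u v h hx

/-- Each iterate multiplies an exponential by at most `symbolSize ^ |β|`, and `pow_mul_exp_le`
absorbs that power uniformly in `β`. The `L²` norm is bounded by the sup norm times the square root
of the volume. -/
lemma seminormK_waveSum_le (hω : IsNonQuasianalyticWeight ω) (hm : 1 ≤ m) (hlam : 0 < lam)
    {ι : Type*} (s : Finset ι) (ξ : ι → EuclideanSpace ℝ (Fin n)) (b : ι → ℂ) :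
    seminormK ω P m lam K (waveSum s ξ b) ≤
      volume (interior K) ^ (1 / 2 : ℝ) * ENNReal.ofReal
        (∑ p ∈ s, ‖b p‖ * Real.exp (lam * ω (symbolSize P (ξ p) ^ (1 / (m : ℝ))))) := by
  refine iSup_le fun β => ?_
  set w := Real.exp (-(lam * youngConj ω (((∑ j, β j : ℕ) : ℝ) * (m : ℝ) / lam))) with hw
  have h1 : eLpNorm (iterateOp P β (waveSum s ξ b)) 2 (volume.restrict (interior K)) ≤
      volume (interior K) ^ (1 / 2 : ℝ) *
        ENNReal.ofReal (∑ p ∈ s, symbolSize P (ξ p) ^ (∑ j, β j) * ‖b p‖) := by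
    refine (eLpNorm_le_of_ae_bound (C := ∑ p ∈ s, symbolSize P (ξ p) ^ (∑ j, β j) * ‖b p‖)
      (Eventually.of_forall fun x => ?_)).trans_eq ?_
    · rw [iterateOp_waveSum]
      refine (norm_waveSum_le s ξ _ x).trans (Finset.sum_le_sum fun p _ => ?_)
      rw [norm_mul]
      exact mul_le_mul_of_nonneg_right (norm_prod_symbol_le P β (ξ p)) (norm_nonneg _)
    · simp
  refine (mul_le_mul_left h1 _).trans ?_
  rw [mul_assoc, ← ENNReal.ofReal_mul (Finset.sum_nonneg fun p _ => mul_nonneg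
    (pow_nonneg (zero_le_one.trans (one_le_symbolSize P _)) _) (norm_nonneg _)), Finset.sum_mul]
  refine mul_le_mul_right (ENNReal.ofReal_le_ofReal (Finset.sum_le_sum fun p _ => ?_)) _
  have h2 := mul_le_mul_of_nonneg_left
    (hω.pow_mul_exp_le (one_le_symbolSize P (ξ p)) hm hlam (∑ j, β j)) (norm_nonneg (b p))
  calc _ = ‖b p‖ * (symbolSize P (ξ p) ^ (∑ j, β j) * w) := by ring
    _ ≤ _ := h2

/-- Partial sums of a series of exponentials form a Cauchy sequence. -/
lemma exists_seminormK_sub_lt (hω : IsNonQuasianalyticWeight ω) (hm : 1 ≤ m) (hlam : 0 < lam)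
    (hK : IsCompact K) (ξ : ℕ → EuclideanSpace ℝ (Fin n)) (b : ℕ → ℂ)
    (hb : Summable fun p => ‖b p‖ * Real.exp (lam * ω (symbolSize P (ξ p) ^ (1 / (m : ℝ)))))
    {ε : ℝ≥0∞} (hε : 0 < ε) : ∃ k₀, ∀ k ≥ k₀, ∀ l ≥ k₀, seminormK ω P m lam K
      (waveSum (Finset.range k) ξ b - waveSum (Finset.range l) ξ b) < ε := by
  set g := fun p => ‖b p‖ * Real.exp (lam * ω (symbolSize P (ξ p) ^ (1 / (m : ℝ)))) with hg
  have hg0 : ∀ p, 0 ≤ g p := fun p => by positivity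
  have hV : volume (interior K) ^ (1 / 2 : ℝ) ≠ ∞ :=
    ENNReal.rpow_ne_top_of_nonneg (by norm_num)
      ((measure_mono interior_subset).trans_lt hK.measure_lt_top).ne
  have hlim : Tendsto (fun k => volume (interior K) ^ (1 / 2 : ℝ) *
      ENNReal.ofReal (∑' p, g p - ∑ p ∈ Finset.range k, g p)) atTop (𝓝 0) := by
    have h1 : Tendsto (fun k => ∑' p, g p - ∑ p ∈ Finset.range k, g p) atTop (𝓝 0) := by
      simpa using hb.hasSum.tendsto_sum_nat.const_sub (∑' p, g p)
    have h2 := ENNReal.tendsto_ofReal h1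
    rw [ENNReal.ofReal_zero] at h2
    simpa using ENNReal.Tendsto.const_mul h2 (Or.inr hV)
  obtain ⟨k₀, hk₀⟩ := eventually_atTop.1 (hlim.eventually_lt_const hε)
  -- Only the moduli of the coefficients matter, so the sign change arising when `k < l` is covered
  -- too.
  have hbound : ∀ l k, k₀ ≤ l → l ≤ k → ∀ b' : ℕ → ℂ, (∀ p, ‖b' p‖ = ‖b p‖) →
      seminormK ω P m lam K (waveSum (Finset.Ico l k) ξ b') < ε := by
    intro l k hl hlk b' hb'
    refine (seminormK_waveSum_le hω hm hlam _ ξ b').trans_lt (lt_of_le_of_lt ?_ (hk₀ l hl))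
    refine mul_le_mul_right (ENNReal.ofReal_le_ofReal ?_) _
    simp only [hb']
    change ∑ p ∈ Finset.Ico l k, g p ≤ _
    rw [Finset.sum_Ico_eq_sub _ hlk]
    exact sub_le_sub_right (hb.sum_le_tsum _ fun p _ => hg0 p) _
  refine ⟨k₀, fun k hk l hl => ?_⟩
  rcases le_total l k with h | h
  · have h1 : waveSum (Finset.range k) ξ b - waveSum (Finset.range l) ξ b =
        waveSum (Finset.Ico l k) ξ b := by
      funext x
      simp only [Pi.sub_apply, waveSum, Finset.sum_Ico_eq_sub _ h]
    rw [h1]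
    exact hbound l k hl h b fun _ => rfl
  · have h1 : waveSum (Finset.range k) ξ b - waveSum (Finset.range l) ξ b =
        waveSum (Finset.Ico k l) ξ fun p => -b p := by
      funext x
      simp only [Pi.sub_apply, waveSum, neg_mul, Finset.sum_neg_distrib,
        Finset.sum_Ico_eq_sub _ h]
      ring
    rw [h1]
    exact hbound k l hk h _ fun _ => norm_neg _

lemma continuous_tsum_wave (ξ : ℕ → EuclideanSpace ℝ (Fin n)) {b : ℕ → ℂ}
    (hb : Summable fun p => ‖b p‖) : Continuous fun x => ∑' p, b p * wave (ξ p) x :=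
  continuous_tsum (fun p => continuous_const.mul (continuous_wave (ξ p))) hb fun p x => by
    rw [norm_mul, norm_wave, mul_one]

lemma tendsto_eLpNorm_waveSum_sub (hK : IsCompact K) (ξ : ℕ → EuclideanSpace ℝ (Fin n)) {b : ℕ → ℂ}
    (hb : Summable fun p => ‖b p‖) :
    Tendsto (fun k => eLpNorm (waveSum (Finset.range k) ξ b - fun x => ∑' p, b p * wave (ξ p) x) 2
      (volume.restrict (interior K))) atTop (𝓝 0) := by
  have hV : volume (interior K) ^ (1 / 2 : ℝ) ≠ ∞ :=
    ENNReal.rpow_ne_top_of_nonneg (by norm_num)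
      ((measure_mono interior_subset).trans_lt hK.measure_lt_top).ne
  have h1 : Tendsto (fun k => ∑' p, ‖b (p + k)‖) atTop (𝓝 0) :=
    tendsto_sum_nat_add fun p => ‖b p‖
  have h2 : Tendsto (fun k => volume (interior K) ^ (1 / 2 : ℝ) *
      ENNReal.ofReal (∑' p, ‖b (p + k)‖)) atTop (𝓝 0) := by
    have h3 := ENNReal.tendsto_ofReal h1
    rw [ENNReal.ofReal_zero] at h3
    simpa using ENNReal.Tendsto.const_mul h3 (Or.inr hV)
  refine tendsto_of_tendsto_of_tendsto_of_le_of_le tendsto_const_nhds h2 (fun _ => zero_le) ?_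
  intro k
  refine (eLpNorm_le_of_ae_bound (C := ∑' p, ‖b (p + k)‖)
    (Eventually.of_forall fun x => ?_)).trans_eq (by simp)
  have hn : ∀ p, ‖b p * wave (ξ p) x‖ = ‖b p‖ := fun p => by rw [norm_mul, norm_wave, mul_one]
  have hs : Summable fun p => b p * wave (ξ p) x := Summable.of_norm (by simpa only [hn] using hb)
  have h4 := hs.sum_add_tsum_nat_add k
  simp only [Pi.sub_apply, waveSum]
  rw [← h4, sub_add_cancel_left, norm_neg]
  have h5 : Summable fun p => ‖b (p + k) * wave (ξ (p + k)) x‖ := by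
    simpa only [hn] using (summable_nat_add_iff k).2 hb
  simpa only [hn] using norm_tsum_le_tsum_norm h5

/-- Under condition `(C)`, a series of exponentials with rapidly decreasing coefficients belongs to
the Beurling class. -/
theorem tsum_wave_mem_beurling {Ω : Set (EuclideanSpace ℝ (Fin n))} (hΩ : IsOpen Ω)
    (hω : IsNonQuasianalyticWeight ω) (hm : 1 ≤ m) (hC : ConditionC ω P m Ω)
    (ξ : ℕ → EuclideanSpace ℝ (Fin n)) (b : ℕ → ℂ)
    (hb : ∀ lam : ℝ, 0 < lam → Summable fun p =>
      ‖b p‖ * Real.exp (lam * ω (symbolSize P (ξ p) ^ (1 / (m : ℝ))))) :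
    (fun x => ∑' p, b p * wave (ξ p) x) ∈ beurling ω P m Ω := by
  have hb1 : Summable fun p => ‖b p‖ := by
    refine Summable.of_nonneg_of_le (fun p => norm_nonneg _) (fun p => ?_) (hb 1 one_pos)
    refine le_mul_of_one_le_right (norm_nonneg _) (Real.one_le_exp ?_)
    rw [one_mul]
    exact hω.nonneg _ (Real.rpow_nonneg (zero_le_one.trans (one_le_symbolSize P _)) _)
  set u : EuclideanSpace ℝ (Fin n) → ℂ := fun x => ∑' p, b p * wave (ξ p) x with hu
  have hucont : Continuous u := continuous_tsum_wave ξ hb1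
  have key : ∀ K, IsCompact K → K ⊆ Ω → ∀ lam : ℝ, 0 < lam → u ∈ spaceK ω P m lam K := by
    intro K hK hKΩ lam hlam
    obtain ⟨v, hv, hlim⟩ := hC lam hlam K hK hKΩ (fun k => waveSum (Finset.range k) ξ b)
      (fun k => ⟨(contDiff_waveSum _ ξ b).contDiffOn,
        (seminormK_waveSum_le hω hm hlam _ ξ b).trans_lt (ENNReal.mul_lt_top
          (ENNReal.rpow_lt_top_of_nonneg (by norm_num)
            ((measure_mono interior_subset).trans_lt hK.measure_lt_top).ne)
          ENNReal.ofReal_lt_top)⟩)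
      (fun ε hε => exists_seminormK_sub_lt hω hm hlam hK ξ b (hb lam hlam) hε)
    have hlim2 : Tendsto (fun k => eLpNorm (waveSum (Finset.range k) ξ b - v) 2
        (volume.restrict (interior K))) atTop (𝓝 0) := by
      -- The weight of the term `β = 0`. It is positive and finite, so convergence in the semi-norm
      -- gives convergence in `L²`.
      set w := ENNReal.ofReal (Real.exp (-(lam * youngConj ω
        (((∑ j, (0 : Fin N → ℕ) j : ℕ) : ℝ) * (m : ℝ) / lam)))) with hw
      have hw0 : w ≠ 0 := by simp [hw, Real.exp_pos]
      have hw1 : w ≠ ∞ := ENNReal.ofReal_ne_top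
      have h1 : Tendsto (fun k => seminormK ω P m lam K (waveSum (Finset.range k) ξ b - v) * w⁻¹)
          atTop (𝓝 0) := by
        simpa using ENNReal.Tendsto.mul_const hlim (Or.inr (ENNReal.inv_ne_top.2 hw0))
      refine tendsto_of_tendsto_of_tendsto_of_le_of_le tendsto_const_nhds h1 (fun _ => zero_le)
        fun k => ?_
      have h2 := le_iSup (fun β : Fin N → ℕ => eLpNorm (iterateOp P β
        (waveSum (Finset.range k) ξ b - v)) 2 (volume.restrict (interior K)) * ENNReal.ofReal
        (Real.exp (-(lam * youngConj ω (((∑ j, β j : ℕ) : ℝ) * (m : ℝ) / lam))))) 0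
      simp only [iterateOp_zero] at h2
      rw [← hw] at h2
      have h3 := mul_le_mul_left h2 w⁻¹
      rwa [mul_assoc, ENNReal.mul_inv_cancel hw0 hw1, mul_one] at h3
    have hvcont : ContinuousOn v (interior K) := hv.1.continuousOn
    have hvm : AEStronglyMeasurable v (volume.restrict (interior K)) :=
      hvcont.aestronglyMeasurable isOpen_interior.measurableSet
    have hum : AEStronglyMeasurable u (volume.restrict (interior K)) :=
      hucont.aestronglyMeasurable
    -- The partial sums tend in `L²` both to `u` (uniform convergence) and to `v`; continuity then
    -- upgrades almost everywhere equality to equality on the interior.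
    have hzero : eLpNorm (u - v) 2 (volume.restrict (interior K)) = 0 := by
      have h1 := (tendsto_eLpNorm_waveSum_sub hK ξ hb1).add hlim2
      rw [add_zero] at h1
      refine le_antisymm (ge_of_tendsto' h1 fun k => ?_) zero_le
      have hsm : AEStronglyMeasurable (waveSum (Finset.range k) ξ b)
          (volume.restrict (interior K)) :=
        (contDiff_waveSum _ ξ b (k := 0)).continuous.aestronglyMeasurable
      have h2 : u - v = (u - waveSum (Finset.range k) ξ b) + (waveSum (Finset.range k) ξ b - v) := by
        abel
      rw [h2]
      refine (eLpNorm_add_le (hum.sub hsm) (hsm.sub hvm) (by norm_num)).trans_eq ?_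
      rw [eLpNorm_sub_comm]
    have hae : u =ᵐ[volume.restrict (interior K)] v := by
      have h1 := (eLpNorm_eq_zero_iff (hum.sub hvm) (by norm_num)).1 hzero
      filter_upwards [h1] with x hx
      exact sub_eq_zero.1 hx
    have heq : EqOn u v (interior K) :=
      Measure.eqOn_open_of_ae_eq hae isOpen_interior hucont.continuousOn hvcont
    exact ⟨hv.1.congr heq, (seminormK_congr heq).trans_lt hv.2⟩
  refine ⟨fun x hx => ?_, key⟩
  obtain ⟨ε, hε, hball⟩ := Metric.nhds_basis_closedBall.mem_iff.1 (hΩ.mem_nhds hx)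
  have h1 := (key _ (isCompact_closedBall x ε) hball 1 one_pos).1
  exact (h1.contDiffAt (isOpen_interior.mem_nhds
    (Metric.ball_subset_interior_closedBall (Metric.mem_ball_self hε)))).contDiffWithinAt

end Beurling

/-! ### A uniform bound for exponentials from the Roumieu class -/

section Roumieu

variable {n M : ℕ}

/-- The series of exponentials with coefficients `a p * c p`. -/
def waveSeries (ξ : ℕ → EuclideanSpace ℝ (Fin n)) (c : ℕ → ℝ) (a : ℕ →ᵇ ℂ)
    (x : EuclideanSpace ℝ (Fin n)) : ℂ :=
  ∑' p, a p * (c p : ℂ) * wave (ξ p) x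

variable {ξ : ℕ → EuclideanSpace ℝ (Fin n)} {c : ℕ → ℝ}

lemma norm_waveSeries_term_le (hc0 : ∀ p, 0 ≤ c p) (a : ℕ →ᵇ ℂ) (p : ℕ) :
    ‖a p * (c p : ℂ)‖ ≤ ‖a‖ * c p := by
  rw [norm_mul, Complex.norm_real, Real.norm_of_nonneg (hc0 p)]
  exact mul_le_mul_of_nonneg_right (a.norm_coe_le_norm p) (hc0 p)

lemma summable_waveSeries_norm (hc0 : ∀ p, 0 ≤ c p) (hc : Summable c) (a : ℕ →ᵇ ℂ) :
    Summable fun p => ‖a p * (c p : ℂ)‖ :=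
  Summable.of_nonneg_of_le (fun _ => norm_nonneg _) (norm_waveSeries_term_le hc0 a)
    (hc.mul_left ‖a‖)

lemma norm_waveSeries_mul_wave (a : ℕ →ᵇ ℂ) (p : ℕ) (x : EuclideanSpace ℝ (Fin n)) :
    ‖a p * (c p : ℂ) * wave (ξ p) x‖ = ‖a p * (c p : ℂ)‖ := by
  rw [norm_mul, norm_wave, mul_one]

lemma summable_waveSeries (hc0 : ∀ p, 0 ≤ c p) (hc : Summable c) (a : ℕ →ᵇ ℂ)
    (x : EuclideanSpace ℝ (Fin n)) : Summable fun p => a p * (c p : ℂ) * wave (ξ p) x :=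
  Summable.of_norm (by simpa only [norm_waveSeries_mul_wave] using summable_waveSeries_norm hc0 hc a)

lemma norm_waveSeries_le (hc0 : ∀ p, 0 ≤ c p) (hc : Summable c) (a : ℕ →ᵇ ℂ)
    (x : EuclideanSpace ℝ (Fin n)) : ‖waveSeries ξ c a x‖ ≤ ‖a‖ * ∑' p, c p := by
  rw [← tsum_mul_left]
  refine tsum_of_norm_bounded (hc.mul_left ‖a‖).hasSum fun p => ?_
  rw [norm_waveSeries_mul_wave]
  exact norm_waveSeries_term_le hc0 a p

lemma waveSeries_sub (hc0 : ∀ p, 0 ≤ c p) (hc : Summable c) (a b : ℕ →ᵇ ℂ)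
    (x : EuclideanSpace ℝ (Fin n)) :
    waveSeries ξ c (a - b) x = waveSeries ξ c a x - waveSeries ξ c b x := by
  simp only [waveSeries]
  rw [← (summable_waveSeries hc0 hc a x).tsum_sub (summable_waveSeries hc0 hc b x)]
  simp only [BoundedContinuousFunction.coe_sub, Pi.sub_apply, sub_mul]

lemma continuous_waveSeries (hc0 : ∀ p, 0 ≤ c p) (hc : Summable c) (a : ℕ →ᵇ ℂ) :
    Continuous (waveSeries ξ c a) :=
  continuous_tsum_wave ξ (summable_waveSeries_norm hc0 hc a)

lemma integral_waveSeries_sub (hc0 : ∀ p, 0 ≤ c p) (hc : Summable c)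
    {U : Set (EuclideanSpace ℝ (Fin n))} (hU : IsOpen U) {ψ : EuclideanSpace ℝ (Fin n) → ℂ}
    (hψ : IsTestFunction U ψ) (a b : ℕ →ᵇ ℂ) :
    ∫ x, waveSeries ξ c (a - b) x * ψ x =
      (∫ x, waveSeries ξ c a x * ψ x) - ∫ x, waveSeries ξ c b x * ψ x := by
  have h := fun a => hψ.integrable_mul hU
    (continuous_waveSeries (ξ := ξ) hc0 hc a).continuousOn
  rw [← integral_sub (h a) (h b)]
  simp only [waveSeries_sub hc0 hc, sub_mul]

/-- Once the derivatives have been moved to the test function, the pairing depends on the series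
only through its sup norm, hence is Lipschitz in `a`. This makes the sets in the Baire argument
closed. -/
lemma continuous_integral_waveSeries (hc0 : ∀ p, 0 ≤ c p) (hc : Summable c)
    {U : Set (EuclideanSpace ℝ (Fin n))} (hU : IsOpen U) {ψ : EuclideanSpace ℝ (Fin n) → ℂ}
    (hψ : IsTestFunction U ψ) :
    Continuous fun a : ℕ →ᵇ ℂ => ∫ x, waveSeries ξ c a x * ψ x := by
  refine (LipschitzWith.of_dist_le' (K := (∑' p, c p) * ∫ x, ‖ψ x‖) fun a b => ?_).continuous
  rw [dist_eq_norm, dist_eq_norm, ← integral_waveSeries_sub hc0 hc hU hψ]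
  have hψi : Integrable ψ := hψ.contDiff.continuous.integrable_of_hasCompactSupport
    hψ.hasCompactSupport
  calc ‖∫ x, waveSeries ξ c (a - b) x * ψ x‖
      ≤ ∫ x, ‖a - b‖ * (∑' p, c p) * ‖ψ x‖ := by
        refine norm_integral_le_of_norm_le (hψi.norm.const_mul _) (Eventually.of_forall fun x => ?_)
        rw [norm_mul]
        exact mul_le_mul_of_nonneg_right (norm_waveSeries_le hc0 hc _ x) (norm_nonneg _)
    _ = _ := by rw [integral_const_mul]; ring

lemma norm_integral_mul_le_of_eLpNorm_le {U : Set (EuclideanSpace ℝ (Fin n))} (hU : IsOpen U)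
    (hUfin : volume U ≠ ∞) {g φ : EuclideanSpace ℝ (Fin n) → ℂ} (hg : ContinuousOn g U)
    (hφ : IsTestFunction U φ) (hφ1 : ∀ x, ‖φ x‖ ≤ 1) {C : ℝ} (hC : 0 ≤ C)
    (h : eLpNorm g 2 (volume.restrict U) ≤ ENNReal.ofReal C) :
    ‖∫ x, g x * φ x‖ ≤ C * ((volume U) ^ (1 / 2 : ℝ)).toReal := by
  have hgm : AEStronglyMeasurable g (volume.restrict U) := hg.aestronglyMeasurable hU.measurableSet
  have hzero : ∀ x, x ∉ U → g x * φ x = 0 := fun x hx => by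
    rw [image_eq_zero_of_notMem_tsupport fun h => hx (hφ.tsupport_subset h), mul_zero]
  rw [← setIntegral_eq_integral_of_forall_compl_eq_zero hzero]
  have h1 : ‖∫ x in U, g x * φ x‖ₑ ≤ eLpNorm g 1 (volume.restrict U) := by
    refine (enorm_integral_le_lintegral_enorm _).trans ?_
    rw [eLpNorm_one_eq_lintegral_enorm]
    refine lintegral_mono fun x => ?_
    rw [enorm_mul]
    refine mul_le_of_le_one_right zero_le ?_
    rw [← ofReal_norm]
    exact ENNReal.ofReal_le_one.2 (hφ1 x)
  have h2 : eLpNorm g 1 (volume.restrict U) ≤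
      eLpNorm g 2 (volume.restrict U) * volume U ^ (1 / 2 : ℝ) := by
    have h3 := eLpNorm_le_eLpNorm_mul_rpow_measure_univ (p := 1) (q := 2) (by norm_num) hgm
    norm_num at h3
    simpa using h3
  have hV : volume U ^ (1 / 2 : ℝ) ≠ ∞ := ENNReal.rpow_ne_top_of_nonneg (by norm_num) hUfin
  have h4 := h1.trans (h2.trans (mul_le_mul_left h _))
  have h5 := ENNReal.toReal_mono (ENNReal.mul_ne_top ENNReal.ofReal_ne_top hV) h4
  rwa [toReal_enorm, ENNReal.toReal_mul, ENNReal.toReal_ofReal hC] at h5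

/-- A smooth function in the space over `K` satisfies the estimates that define it. -/
lemma exists_eLpNorm_iterateOp_le {σ : ℝ → ℝ} {Q : Fin M → MvPolynomial (Fin n) ℂ} {r : ℕ}
    {lam : ℝ} {K : Set (EuclideanSpace ℝ (Fin n))} {u : EuclideanSpace ℝ (Fin n) → ℂ}
    (hu : u ∈ spaceK σ Q r lam K) : ∃ C : ℝ, 0 ≤ C ∧ ∀ β : Fin M → ℕ,
      eLpNorm (iterateOp Q β u) 2 (volume.restrict (interior K)) ≤ ENNReal.ofReal
        (C * Real.exp (lam * youngConj σ (((∑ j, β j : ℕ) : ℝ) * (r : ℝ) / lam))) := by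
  refine ⟨(seminormK σ Q r lam K u).toReal, ENNReal.toReal_nonneg, fun β => ?_⟩
  set w := lam * youngConj σ (((∑ j, β j : ℕ) : ℝ) * (r : ℝ) / lam) with hw
  have h1 : eLpNorm (iterateOp Q β u) 2 (volume.restrict (interior K)) *
      ENNReal.ofReal (Real.exp (-w)) ≤ seminormK σ Q r lam K u :=
    le_iSup (fun β : Fin M → ℕ => eLpNorm (iterateOp Q β u) 2 (volume.restrict (interior K)) *
      ENNReal.ofReal
        (Real.exp (-(lam * youngConj σ (((∑ j, β j : ℕ) : ℝ) * (r : ℝ) / lam))))) β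
  have h2 := mul_le_mul_left h1 (ENNReal.ofReal (Real.exp w))
  rw [mul_assoc, ← ENNReal.ofReal_mul (Real.exp_pos _).le, ← Real.exp_add, neg_add_cancel,
    Real.exp_zero, ENNReal.ofReal_one, mul_one] at h2
  rwa [ENNReal.ofReal_mul ENNReal.toReal_nonneg, ENNReal.ofReal_toReal hu.2.ne]

/-- If all series of exponentials with coefficients `O(c p)` belong to the Roumieu class, then the
exponentials satisfy uniform estimates with a single parameter. -/
theorem exists_uniform_bound_of_mem_roumieu {Ω : Set (EuclideanSpace ℝ (Fin n))} (hΩ : IsOpen Ω)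
    (hne : Ω.Nonempty) {σ : ℝ → ℝ} {Q : Fin M → MvPolynomial (Fin n) ℂ} {r : ℕ}
    (hc0 : ∀ p, 0 ≤ c p) (hc : Summable c)
    (hmem : ∀ a : ℕ →ᵇ ℂ, waveSeries ξ c a ∈ roumieu σ Q r Ω) :
    ∃ lam : ℝ, 0 < lam ∧ ∃ C : ℝ, ∀ (β : Fin M → ℕ) (p : ℕ),
      c p * ‖∏ j, symbol (Q j) (ξ p) ^ β j‖ ≤
        C * Real.exp (lam * youngConj σ (((∑ j, β j : ℕ) : ℝ) * (r : ℝ) / lam)) := by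
  obtain ⟨x₀, hx₀⟩ := hne
  obtain ⟨ε, hε, hball⟩ := Metric.nhds_basis_closedBall.mem_iff.1 (hΩ.mem_nhds hx₀)
  set K := Metric.closedBall x₀ ε with hKdef
  have hK : IsCompact K := isCompact_closedBall x₀ ε
  set U := interior K with hUdef
  have hU : IsOpen U := isOpen_interior
  have hUfin : volume U ≠ ∞ := ((measure_mono interior_subset).trans_lt hK.measure_lt_top).ne
  have hxU : x₀ ∈ U := Metric.ball_subset_interior_closedBall (Metric.mem_ball_self hε)
  obtain ⟨χ, hχ1, hχ2, hχ3, hχ4, hχ5⟩ := exists_contDiff_tsupport_subset (n := ⊤) (hU.mem_nhds hxU)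
  have hχ0 : ∀ x, 0 ≤ χ x := fun x => (hχ4 ⟨x, rfl⟩).1
  have hχpos : 0 < ∫ x, χ x :=
    hχ3.continuous.integral_pos_of_hasCompactSupport_nonneg_nonzero hχ2 hχ0 (x := x₀) (by simp [hχ5])
  have hχtest : IsTestFunction U fun x => (χ x : ℂ) := by
    refine ⟨Complex.ofRealCLM.contDiff.comp hχ3, hχ2.comp_left Complex.ofReal_zero, ?_⟩
    have hsub : Function.support (fun x => (χ x : ℂ)) ⊆ Function.support χ := fun x hx => by
      simpa using hx
    exact (closure_mono hsub).trans hχ1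
  -- A cutoff modulated by the opposite frequency: paired with `wave (ξ p)` it gives `∫ χ`,
  -- independently of `p`.
  set φ : ℕ → EuclideanSpace ℝ (Fin n) → ℂ := fun p x => wave (-ξ p) x * (χ x : ℂ) with hφdef
  have hφ : ∀ p, IsTestFunction U (φ p) := fun p => hχtest.mul_left (contDiff_wave _)
  have hφ1 : ∀ p x, ‖φ p x‖ ≤ 1 := fun p x => by
    simp only [hφdef]
    rw [norm_mul, norm_wave, one_mul, Complex.norm_real, Real.norm_of_nonneg (hχ0 x)]
    exact (hχ4 ⟨x, rfl⟩).2
  have hQ : ∀ β, IsLocalOperator U (iterateOp Q β) := IsLocalOperator.iterateOp hU Q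
  choose ψ hψ hψeq using fun (β : Fin M → ℕ) (p : ℕ) => (hQ β).transpose (φ p) (hφ p)
  set F : (Fin M → ℕ) → ℕ → (ℕ →ᵇ ℂ) → ℂ := fun β p a => ∫ x, waveSeries ξ c a x * ψ β p x with hF
  set w : ℝ → (Fin M → ℕ) → ℝ := fun lam β =>
    Real.exp (lam * youngConj σ (((∑ j, β j : ℕ) : ℝ) * (r : ℝ) / lam)) with hw
  -- Countably many sets, indexed by the Roumieu parameter and an integer bound. They are uniform in
  -- `β` and in `p`, the latter because all test functions satisfy `‖φ p‖ ≤ 1`.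
  set B : {l : ℕ // 0 < l} × ℕ → Set (ℕ →ᵇ ℂ) := fun i =>
    {a | ∀ β p, ‖F β p a‖ ≤ i.2 * w (1 / (i.1 : ℕ)) β} with hB
  have hBclosed : ∀ i, IsClosed (B i) := fun i => by
    simp only [hB, ofPred_forall]
    exact isClosed_iInter fun β => isClosed_iInter fun p => isClosed_le
      (continuous_integral_waveSeries hc0 hc hU (hψ β p)).norm continuous_const
  have hBcover : ⋃ i, B i = univ := by
    refine eq_univ_of_forall fun a => ?_
    obtain ⟨hsm, hK'⟩ := hmem a
    obtain ⟨l, hl, hmemK⟩ := hK' K hK hball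
    obtain ⟨C, hC, hbound⟩ := exists_eLpNorm_iterateOp_le hmemK
    obtain ⟨k, hk⟩ := exists_nat_ge (C * ((volume U) ^ (1 / 2 : ℝ)).toReal)
    refine mem_iUnion.2 ⟨(⟨l, hl⟩, k), fun β p => ?_⟩
    have hsmU : ContDiffOn ℝ (⊤ : ℕ∞) (waveSeries ξ c a) U := hmemK.1
    have h1 := norm_integral_mul_le_of_eLpNorm_le hU hUfin ((hQ β).smooth _ hsmU).continuousOn
      (hφ p) (hφ1 p) (mul_nonneg hC (Real.exp_pos _).le) (hbound β)
    rw [hψeq β p _ hsmU] at h1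
    refine h1.trans ?_
    rw [mul_right_comm]
    exact mul_le_mul_of_nonneg_right hk (Real.exp_pos _).le
  obtain ⟨⟨l, k⟩, a₀, ha₀⟩ := nonempty_interior_of_iUnion_of_closed hBclosed hBcover
  obtain ⟨δ, hδ, hδball⟩ := Metric.isOpen_iff.1 isOpen_interior a₀ ha₀
  refine ⟨1 / (l : ℕ), by have := l.2; positivity, 2 * k / (δ / 2 * ∫ x, χ x), fun β p => ?_⟩
  have hδ2 : 0 < δ / 2 := by positivity
  -- The `p`-th unit sequence scaled by `δ / 2`, so that `a₀ + e` stays in the open ball;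
  -- subtracting the bounds at `a₀ + e` and `a₀` isolates the `p`-th exponential at the cost of a
  -- factor `2`.
  set e : ℕ →ᵇ ℂ := BoundedContinuousFunction.ofNormedAddCommGroupDiscrete
    (fun q => if q = p then ((δ / 2 : ℝ) : ℂ) else 0) (δ / 2) (fun q => by
      split_ifs
      · rw [Complex.norm_real, Real.norm_of_nonneg hδ2.le]
      · simpa using hδ2.le) with he
  have henorm : ‖e‖ ≤ δ / 2 := by
    refine (BoundedContinuousFunction.norm_le hδ2.le).2 fun q => ?_
    simp only [he, BoundedContinuousFunction.coe_ofNormedAddCommGroupDiscrete]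
    split_ifs
    · rw [Complex.norm_real, Real.norm_of_nonneg hδ2.le]
    · simpa using hδ2.le
  have hmem1 : a₀ + e ∈ B (l, k) := interior_subset (hδball (by
    rw [Metric.mem_ball, dist_eq_norm, add_sub_cancel_left]; linarith))
  have hmem0 : a₀ ∈ B (l, k) := interior_subset ha₀
  have hFe : F β p e = F β p (a₀ + e) - F β p a₀ := by
    simp only [hF]
    rw [← integral_waveSeries_sub hc0 hc hU (hψ β p), add_sub_cancel_left]
  have hle : ‖F β p e‖ ≤ 2 * k * w (1 / (l : ℕ)) β := by
    rw [hFe]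
    refine (norm_sub_le _ _).trans ?_
    have h0 := hmem0 β p
    have h1 := hmem1 β p
    simp only at h0 h1
    linarith
  have hseries : waveSeries ξ c e = fun x => ((δ / 2 * c p : ℝ) : ℂ) * wave (ξ p) x := by
    funext x
    rw [waveSeries, tsum_eq_single p fun q hq => by simp [he, hq]]
    simp [he]
  have hval : F β p e = ((δ / 2 * c p : ℝ) : ℂ) * ((∏ j, symbol (Q j) (ξ p) ^ β j) *
      ((∫ x, χ x : ℝ) : ℂ)) := by
    simp only [hF, hseries, mul_assoc]
    rw [integral_const_mul, ← hψeq β p _ (contDiff_wave (ξ p)).contDiffOn, iterateOp_wave]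
    congr 1
    have h1 : ∀ x, (∏ j, symbol (Q j) (ξ p) ^ β j) * wave (ξ p) x * φ p x =
        (∏ j, symbol (Q j) (ξ p) ^ β j) * (χ x : ℂ) := fun x => by
      simp only [hφdef]
      linear_combination ((∏ j, symbol (Q j) (ξ p) ^ β j) * (χ x : ℂ)) * wave_neg_mul_wave (ξ p) x
    simp only [h1]
    rw [integral_const_mul, integral_complex_ofReal]
  rw [hval, norm_mul, norm_mul, Complex.norm_real, Complex.norm_real, Real.norm_of_nonneg hχpos.le,
    Real.norm_of_nonneg (mul_nonneg hδ2.le (hc0 p))] at hle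
  rw [div_mul_eq_mul_div, le_div_iff₀ (by positivity)]
  calc _ = δ / 2 * c p * (‖∏ j, symbol (Q j) (ξ p) ^ β j‖ * ∫ x, χ x) := by ring
    _ ≤ _ := hle

end Roumieu

/-! ### Comparison of symbols along a sequence of frequencies -/

section Comparison

variable {n N M : ℕ}

lemma beurling_subset_roumieu (ω : ℝ → ℝ) (P : Fin N → MvPolynomial (Fin n) ℂ) (m : ℕ)
    (Ω : Set (EuclideanSpace ℝ (Fin n))) : beurling ω P m Ω ⊆ roumieu ω P m Ω :=
  fun _ hu => ⟨hu.1, fun K hK hKΩ => ⟨1, one_pos, hu.2 K hK hKΩ _ (by simp)⟩⟩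

/-- `σ ∘ exp` is the convex function `ω ∘ exp` with its argument rescaled by `κ`. With monotonicity,
this is all that the conjugate argument needs of `σ`. -/
lemma IsNonQuasianalyticWeight.convexOn_comp_rpow {ω σ : ℝ → ℝ} (hω : IsNonQuasianalyticWeight ω)
    {κ : ℝ} (hσ : ∀ t, 0 ≤ t → σ t = ω (t ^ κ)) :
    ConvexOn ℝ univ fun t => σ (Real.exp t) := by
  have h1 : (fun t => σ (Real.exp t)) = fun t => ω (Real.exp (κ * t)) := by
    funext t
    rw [hσ _ (Real.exp_pos t).le, ← Real.exp_mul, mul_comm]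
  rw [h1]
  exact hω.delta.comp_linearMap (LinearMap.mulLeft ℝ κ)

lemma IsNonQuasianalyticWeight.monotone_comp_rpow {ω σ : ℝ → ℝ} (hω : IsNonQuasianalyticWeight ω)
    {κ : ℝ} (hκ : 0 ≤ κ) (hσ : ∀ t, 0 ≤ t → σ t = ω (t ^ κ)) :
    Monotone fun t => σ (Real.exp t) := by
  intro s t hst
  simp only
  rw [hσ _ (Real.exp_pos s).le, hσ _ (Real.exp_pos t).le]
  exact hω.monotoneOn (Real.rpow_nonneg (Real.exp_pos s).le _)
    (Real.rpow_nonneg (Real.exp_pos t).le _)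
    (Real.rpow_le_rpow (Real.exp_pos s).le (Real.exp_le_exp.2 hst) hκ)

/-- Along a sequence of frequencies, uniform estimates on the exponentials bound the growth of the
weight at the symbol of `Q j`. -/
lemma exp_le_of_uniform_bound {ω σ : ℝ → ℝ} (hω : IsNonQuasianalyticWeight ω)
    {Q : Fin M → MvPolynomial (Fin n) ℂ} {r : ℕ} (hr : 0 < r) {a : ℝ} (ha : 0 < a)
    (hσ : ∀ t, 0 ≤ t → σ t = ω (t ^ ((r : ℝ) / a))) {lam C c : ℝ} (hlam : 0 < lam) (hc : 0 ≤ c)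
    {ξ : EuclideanSpace ℝ (Fin n)}
    (hbound : ∀ β : Fin M → ℕ, c * ‖∏ j, symbol (Q j) ξ ^ β j‖ ≤
      C * Real.exp (lam * youngConj σ (((∑ j, β j : ℕ) : ℝ) * (r : ℝ) / lam)))
    (j : Fin M) (hq : 1 ≤ ‖symbol (Q j) ξ‖) :
    c * Real.exp (lam * ω (‖symbol (Q j) ξ‖ ^ (1 / a)) - Real.log ‖symbol (Q j) ξ‖) ≤ C := by
  set q := ‖symbol (Q j) ξ‖ with hqdef
  have hq0 : 0 < q := by linarith
  have hr' : (0 : ℝ) < r := by exact_mod_cast hr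
  -- Taken at `t = log q / r`: then `σ (e^t) = ω (q ^ (1/a))` and the rounding loss `r * t` is `log
  -- q`.
  obtain ⟨k, hk⟩ := exists_nat_le_youngConj (hω.convexOn_comp_rpow hσ)
    (hω.monotone_comp_rpow (by positivity) hσ) hr' hlam
    (div_nonneg (Real.log_nonneg hq) hr'.le)
  have hβ := hbound (Pi.single j k)
  have h1 : ∏ i, symbol (Q i) ξ ^ (Pi.single j k : Fin M → ℕ) i = symbol (Q j) ξ ^ k := by
    rw [Finset.prod_eq_single j (fun i _ hi => by simp [Pi.single_eq_of_ne hi]) (by simp)]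
    simp
  rw [h1, Finset.sum_pi_single' j k, if_pos (Finset.mem_univ j), norm_pow, ← hqdef] at hβ
  have h2 : σ (Real.exp (Real.log q / r)) = ω (q ^ (1 / a)) := by
    rw [hσ _ (Real.exp_pos _).le, ← Real.exp_mul, Real.rpow_def_of_pos hq0]
    congr 2
    field_simp
  rw [h2, mul_div_cancel₀ _ hr'.ne'] at hk
  have h3 : q ^ k = Real.exp (k * Real.log q) := by rw [Real.exp_nat_mul, Real.exp_log hq0]
  calc c * Real.exp (lam * ω (q ^ (1 / a)) - Real.log q)
      ≤ c * Real.exp (k * Real.log q - lam * youngConj σ (k * r / lam)) :=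
        mul_le_mul_of_nonneg_left (Real.exp_le_exp.2 hk) hc
    _ = c * q ^ k / Real.exp (lam * youngConj σ (k * r / lam)) := by
        rw [Real.exp_sub, h3, ← mul_div_assoc]
    _ ≤ C := (div_le_iff₀ (Real.exp_pos _)).2 hβ

/-- Summability of the coefficients `(1/2)^p exp(-(3/4)^p z_p)` against `exp(lam y_p)` when `z_p`
is much larger than `y_p`. -/
lemma summable_exp_mul_exp {y z : ℕ → ℝ} {H : ℝ} (hz : ∀ p, 0 ≤ z p)
    (hyz : ∀ p, 2 ^ p * (y p - H) ≤ z p) {lam : ℝ} (hlam : 0 < lam) :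
    Summable fun p => ((1 / 2 : ℝ) ^ p * Real.exp (-((3 / 4 : ℝ) ^ p * z p))) *
      Real.exp (lam * y p) := by
  -- Since `2/3 = (1/2) / (3/4)`, eventually `lam * (1/2) ^ p ≤ (3/4) ^ p`. The exponent is then at
  -- most `lam * H`, leaving a geometric series.
  have hlim : Tendsto (fun p : ℕ => lam * (2 / 3 : ℝ) ^ p) atTop (𝓝 0) := by
    simpa using (tendsto_pow_atTop_nhds_zero_of_lt_one (r := (2 / 3 : ℝ)) (by norm_num)
      (by norm_num)).const_mul lam
  refine Summable.of_norm_bounded_eventually_nat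
    ((summable_geometric_two).mul_left (Real.exp (lam * H))) ?_
  filter_upwards [hlim.eventually_le_const one_pos] with p hp
  rw [Real.norm_of_nonneg (by positivity), mul_assoc, ← Real.exp_add, mul_comm]
  refine mul_le_mul_of_nonneg_right (Real.exp_le_exp.2 ?_) (by positivity)
  have h1 : y p - H ≤ (1 / 2) ^ p * z p := by
    rw [one_div, inv_pow, inv_mul_eq_div, le_div_iff₀' (by positivity)]
    exact hyz p
  have h2 : lam * (1 / 2 : ℝ) ^ p ≤ (3 / 4) ^ p := by
    have h3 : (1 / 2 : ℝ) ^ p = (2 / 3) ^ p * (3 / 4) ^ p := by rw [← mul_pow]; norm_num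
    rw [h3, ← mul_assoc]
    exact mul_le_of_le_one_left (by positivity) hp
  have h4 := mul_le_mul_of_nonneg_left h1 hlam.le
  have h5 := mul_le_mul_of_nonneg_right h2 (hz p)
  linarith

theorem exists_symbol_le {Ω : Set (EuclideanSpace ℝ (Fin n))} (hΩ : IsOpen Ω)
    (hne : Ω.Nonempty) {ω : ℝ → ℝ} (hω : IsNonQuasianalyticWeight ω) (hBMM : ConditionBMM ω)
    {P : Fin N → MvPolynomial (Fin n) ℂ} {m : ℕ} (hm : 1 ≤ m) (hC : ConditionC ω P m Ω)
    {Q : Fin M → MvPolynomial (Fin n) ℂ} {r : ℕ} (hr : 0 < r) {h : ℝ} (hh : 0 < h) {σ : ℝ → ℝ}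
    (hσ : ∀ t, 0 ≤ t → σ t = ω (t ^ ((r : ℝ) / ((m : ℝ) * h))))
    (hincl : beurling ω P m Ω ⊆ roumieu σ Q r Ω) (j : Fin M) :
    ∃ C : ℝ, ∀ ξ : EuclideanSpace ℝ (Fin n), ‖symbol (Q j) ξ‖ ≤ C * symbolSize P ξ ^ h := by
  by_contra! hcon
  obtain ⟨H, hH, hpow⟩ := hBMM.exists_pow
  have hm' : (0 : ℝ) < m := by exact_mod_cast hm
  set a : ℝ := m * h with hadef
  have ha : 0 < a := mul_pos hm' hh
  -- The factor `(H ^ p) ^ a` becomes `H ^ p` after taking the power `1 / a`, ready for `p`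
  -- applications of B-M-M; the factor `exp p` forces `p ≤ log (q p)`.
  choose ξ hξ using fun p : ℕ => hcon ((H ^ p) ^ a * Real.exp p)
  set q : ℕ → ℝ := fun p => ‖symbol (Q j) (ξ p)‖ with hqdef
  set S : ℕ → ℝ := fun p => symbolSize P (ξ p) with hSdef
  have hS : ∀ p, 1 ≤ S p := fun p => one_le_symbolSize P (ξ p)
  have hS0 : ∀ p, 0 ≤ S p := fun p => zero_le_one.trans (hS p)
  have hHp : ∀ p : ℕ, 1 ≤ H ^ p := fun p => one_le_pow₀ hH
  have hHpa : ∀ p : ℕ, 1 ≤ (H ^ p) ^ a := fun p => Real.one_le_rpow (hHp p) ha.le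
  have hSh : ∀ p, 1 ≤ S p ^ h := fun p => Real.one_le_rpow (hS p) hh.le
  have hqexp : ∀ p : ℕ, Real.exp p ≤ q p := fun p => by
    refine le_trans ?_ (hξ p).le
    refine le_trans ?_ (le_mul_of_one_le_right (by positivity) (hSh p))
    exact le_mul_of_one_le_left (Real.exp_pos _).le (hHpa p)
  have hq1 : ∀ p, 1 ≤ q p := fun p => (Real.one_le_exp p.cast_nonneg).trans (hqexp p)
  have hq0 : ∀ p, 0 < q p := fun p => zero_lt_one.trans_le (hq1 p)
  have hlogq : ∀ p : ℕ, (p : ℝ) ≤ Real.log (q p) := fun p =>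
    (Real.le_log_iff_exp_le (hq0 p)).2 (hqexp p)
  set y : ℕ → ℝ := fun p => ω (S p ^ (1 / (m : ℝ))) with hydef
  set z : ℕ → ℝ := fun p => ω (q p ^ (1 / a)) with hzdef
  have hz0 : ∀ p, 0 ≤ z p := fun p => hω.nonneg _ (Real.rpow_nonneg (hq0 p).le _)
  have hle : ∀ p, H ^ p * S p ^ (1 / (m : ℝ)) ≤ q p ^ (1 / a) := fun p => by
    have h1 : (H ^ p) ^ a * S p ^ h ≤ q p := by
      refine le_trans ?_ (hξ p).le
      refine mul_le_mul_of_nonneg_right ?_ (zero_le_one.trans (hSh p))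
      exact le_mul_of_one_le_right (zero_le_one.trans (hHpa p)) (Real.one_le_exp p.cast_nonneg)
    have hH0 : 0 ≤ H ^ p := zero_le_one.trans (hHp p)
    have h2 := Real.rpow_le_rpow (mul_nonneg (Real.rpow_nonneg hH0 _) (Real.rpow_nonneg (hS0 p) _))
      h1 (show 0 ≤ 1 / a by positivity)
    rw [Real.mul_rpow (Real.rpow_nonneg hH0 _) (Real.rpow_nonneg (hS0 p) _), ← Real.rpow_mul hH0,
      ← Real.rpow_mul (hS0 p), mul_one_div_cancel ha.ne', Real.rpow_one] at h2
    have h3 : h * (1 / a) = 1 / m := by rw [hadef]; field_simp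
    rwa [h3] at h2
  have hyz : ∀ p, 2 ^ p * (y p - H) ≤ z p := fun p => by
    have h1 := hpow p (S p ^ (1 / (m : ℝ))) (Real.rpow_nonneg (hS0 p) _)
    have h2 : ω (H ^ p * S p ^ (1 / (m : ℝ))) ≤ ω (q p ^ (1 / a)) :=
      hω.monotoneOn (mul_nonneg (zero_le_one.trans (hHp p)) (Real.rpow_nonneg (hS0 p) _))
        (Real.rpow_nonneg (hq0 p).le _) (hle p)
    simp only [hydef, hzdef]
    linarith
  -- Any ratio strictly between `1/2` and `1` could replace `3/4`: it must dominate the `2 ^ (-p)`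
  -- from B-M-M and still tend to zero.
  set c : ℕ → ℝ := fun p => (1 / 2 : ℝ) ^ p * Real.exp (-((3 / 4 : ℝ) ^ p * z p)) with hcdef
  have hc0 : ∀ p, 0 ≤ c p := fun p => by positivity
  have hcsum : Summable c := by
    refine Summable.of_nonneg_of_le hc0 (fun p => ?_) summable_geometric_two
    refine mul_le_of_le_one_right (by positivity) (Real.exp_le_one_iff.2 ?_)
    exact neg_nonpos.2 (mul_nonneg (by positivity) (hz0 p))
  have hmem : ∀ b : ℕ →ᵇ ℂ, waveSeries ξ c b ∈ roumieu σ Q r Ω := fun b => by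
    refine hincl (tsum_wave_mem_beurling hΩ hω hm hC ξ _ fun lam hlam => ?_)
    refine Summable.of_nonneg_of_le (fun p => by positivity) (fun p => ?_)
      ((summable_exp_mul_exp hz0 hyz hlam).mul_left ‖b‖)
    rw [← mul_assoc]
    exact mul_le_mul_of_nonneg_right (norm_waveSeries_term_le hc0 b p) (Real.exp_pos _).le
  obtain ⟨lam, hlam, C, hbound⟩ := exists_uniform_bound_of_mem_roumieu hΩ hne hc0 hcsum hmem
  have hkey : ∀ p, c p * Real.exp (lam * z p - Real.log (q p)) ≤ C := fun p =>
    exp_le_of_uniform_bound hω hr ha hσ hlam (hc0 p) (fun β => hbound β p) j (hq1 p)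
  have hqlim : Tendsto (fun p => q p ^ (1 / a)) atTop atTop :=
    (tendsto_rpow_atTop (show 0 < 1 / a by positivity)).comp
      (tendsto_atTop_mono hqexp (Real.tendsto_exp_atTop.comp tendsto_natCast_atTop_atTop))
  have hlog : ∀ᶠ p in atTop, Real.log (q p) ≤ lam / 8 * z p := by
    filter_upwards [hqlim.eventually (hω.gamma.bound (show 0 < lam / 8 / a by positivity))] with p hp
    have h1 := (le_abs_self _).trans hp
    rw [Real.norm_of_nonneg (hz0 p), Real.log_rpow (hq0 p)] at h1
    have h2 := mul_le_mul_of_nonneg_left h1 ha.le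
    have h3 : a * (1 / a * Real.log (q p)) = Real.log (q p) := by field_simp
    have h4 : a * (lam / 8 / a * z p) = lam / 8 * z p := by field_simp
    rwa [h3, h4] at h2
  have hsmall : ∀ᶠ p : ℕ in atTop, (3 / 4 : ℝ) ^ p ≤ lam / 4 :=
    (tendsto_pow_atTop_nhds_zero_of_lt_one (r := (3 / 4 : ℝ)) (by norm_num)
      (by norm_num)).eventually_le_const (by positivity)
  have hlarge : ∀ᶠ p : ℕ in atTop, C < Real.exp p :=
    (Real.tendsto_exp_atTop.comp tendsto_natCast_atTop_atTop).eventually_gt_atTop C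
  obtain ⟨p, hp1, hp2, hp3⟩ := (hlog.and (hsmall.and hlarge)).exists
  refine absurd (hkey p) (not_le.2 (hp3.trans_le ?_))
  have h2 : Real.exp (-p) ≤ (1 / 2 : ℝ) ^ p := by
    have h3 : Real.exp (-p) = (Real.exp (-1)) ^ p := by
      rw [← Real.exp_nat_mul, mul_neg_one]
    rw [h3]
    refine pow_le_pow_left₀ (Real.exp_pos _).le ?_ p
    rw [Real.exp_neg, one_div]
    exact inv_anti₀ two_pos (by linarith [Real.add_one_le_exp (1 : ℝ)])
  -- With `z = z p`, the terms `p`, `p` and `log (q p)` total at most `3 log (q p) ≤ (3/8) lam z`,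
  -- and `(3/4) ^ p z ≤ (1/4) lam z`; together they stay below `lam z`.
  calc Real.exp p ≤ Real.exp (-p + -((3 / 4 : ℝ) ^ p * z p) + (lam * z p - Real.log (q p))) := by
        refine Real.exp_le_exp.2 ?_
        have h4 := mul_le_mul_of_nonneg_right hp2 (hz0 p)
        have h5 := hlogq p
        linarith
    _ = Real.exp (-p) * Real.exp (-((3 / 4 : ℝ) ^ p * z p)) *
          Real.exp (lam * z p - Real.log (q p)) := by rw [Real.exp_add, Real.exp_add]
    _ ≤ _ := by
        refine mul_le_mul_of_nonneg_right ?_ (Real.exp_pos _).le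
        exact mul_le_mul_of_nonneg_right h2 (Real.exp_pos _).le

lemma isWeaker_of_forall_exists {h : ℝ} (hh : 0 < h) {Q : Fin M → MvPolynomial (Fin n) ℂ}
    {P : Fin N → MvPolynomial (Fin n) ℂ}
    (H : ∀ j, ∃ C : ℝ, ∀ ξ, ‖symbol (Q j) ξ‖ ≤ C * symbolSize P ξ ^ h) : IsWeaker h Q P := by
  choose C hC using H
  refine ⟨hh, 1 + ∑ j, |C j|, by positivity, fun ξ => ?_⟩
  have hS : 0 ≤ symbolSize P ξ ^ h :=
    Real.rpow_nonneg (zero_le_one.trans (one_le_symbolSize P ξ)) h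
  change _ ≤ _ * symbolSize P ξ ^ h
  rw [add_mul, one_mul, Finset.sum_mul]
  refine le_trans (Finset.sum_le_sum fun j _ => ?_) (le_add_of_nonneg_left hS)
  exact (hC j ξ).trans (mul_le_mul_of_nonneg_right (le_abs_self _) hS)

lemma exists_symbol_le_of_totalDegree_eq_zero {q : MvPolynomial (Fin n) ℂ}
    (hq : q.totalDegree = 0) (P : Fin N → MvPolynomial (Fin n) ℂ) {h : ℝ} (hh : 0 < h) :
    ∃ C : ℝ, ∀ ξ, ‖symbol q ξ‖ ≤ C * symbolSize P ξ ^ h := by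
  refine ⟨‖q.coeff 0‖, fun ξ => ?_⟩
  rw [MvPolynomial.totalDegree_eq_zero_iff_eq_C.1 hq]
  simp only [symbol, MvPolynomial.eval_C, MvPolynomial.coeff_C, if_true]
  exact le_mul_of_one_le_right (norm_nonneg _) (Real.one_le_rpow (one_le_symbolSize P ξ) hh.le)

end Comparison

end Iterates

end

theorem theorem2 {n N M : ℕ} (Ω : Set (EuclideanSpace ℝ (Fin n))) (hΩ : IsOpen Ω)
    (hne : Ω.Nonempty) (ω : ℝ → ℝ) (hω : Iterates.IsNonQuasianalyticWeight ω)
    (hBMM : Iterates.ConditionBMM ω)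
    (P : Fin N → MvPolynomial (Fin n) ℂ) (m : ℕ) (hm : 1 ≤ m) (hP : Iterates.HasOrder P m)
    (hC : Iterates.ConditionC ω P m Ω)
    (Q : Fin M → MvPolynomial (Fin n) ℂ) (r : ℕ) (hQ : Iterates.HasOrder Q r)
    (h : ℝ) (hh : 0 < h) (σ : ℝ → ℝ)
    (hσ : ∀ t, 0 ≤ t → σ t = ω (t ^ ((r : ℝ) / ((m : ℝ) * h))))
    (hincl : Iterates.beurling ω P m Ω ⊆ Iterates.beurling σ Q r Ω ∨
      Iterates.roumieu ω P m Ω ⊆ Iterates.roumieu σ Q r Ω) :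
    Iterates.IsWeaker h Q P := by
  refine Iterates.isWeaker_of_forall_exists hh fun j => ?_
  -- For `r = 0` the function `σ` is constant and the conjugate argument, which divides by `r`, is
  -- unavailable; but then every `Q j` is a constant, and `symbolSize P` is at least `1`.
  rcases Nat.eq_zero_or_pos r with hr | hr
  · exact Iterates.exists_symbol_le_of_totalDegree_eq_zero ((hQ j).trans hr) P hh
  · refine Iterates.exists_symbol_le hΩ hne hω hBMM hm hC hr hh hσ ?_ j
    rcases hincl with hB | hR
    · exact hB.trans (Iterates.beurling_subset_roumieu σ Q r Ω)
    · exact (Iterates.beurling_subset_roumieu ω P m Ω).trans hR
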